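/- For $\lambda\in\mathbb{C}$ put $S=\begin{pmatrix}1&0\\1&1\end{pmatrix}$ and $T_\lambda=\begin{pmatrix}1&2\lambda\\0&1\end{pmatrix}$, and let $G_\lambda\le PSL(2,\mathbb{C})$ be the group generated by the classes of $S$ and $T_\lambda$. Let $f(z)=-2z^2$, and let $f^n$ be its $n$-th iterate. A parabolic element $h$ of a subgroup $G\le PSL(2,\mathbb{C})$ is a primitive parabolic of $G$ if $h=g^m$ with $g\in G$, $m\in\mathbb{Z}$ implies $m=\pm1$. The group $G$ is parabolic dust if it has at least three conjugacy classes of primitive parabolics, where a parabolic and its inverse are counted as one class; that is, if $G$ contains primitive parabolics $h_1,h_2,h_3$ such that $h_i$ is not conjugate in $G$ to $h_j$ or $h_j^{-1}$ for $i\ne j$. For a rational number $p/q$ in lowest terms with $q\ge1$, the Farey word $W_{p/q}$ is the word of length $2q$ in $S,T$ read off from the simple closed curve of slope $p/q$ on the four-punctured sphere: $$W_{p/q}=\prod_{i=0}^{2q-1}U_i,\qquad U_i=S^{\varepsilon_i}\ (i\text{ even}),\quad U_i=T^{-\varepsilon_i}\ (i\text{ odd}),\qquad \varepsilon_i=(-1)^{\lfloor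 ip/q\rfloor},$$ the factors being taken in increasing order of $i$ (for example $W_{0}=ST^{-1}$, $W_1=ST$, $W_{1/2}=ST^{-1}S^{-1}T$). Let $\lambda_{p/q}$ denote any complex number $\mu$ such that the matrix $W_{p/q}(S,T_\mu)\in SL(2,\mathbb{C})$ has trace $-2$; this includes the cusps on the boundary of the Riley slice. **Corollary.** Let $\lambda\in\mathbb{C}\setminus\{0\}$, let $n\ge0$ be an integer and let $p/q$ be a rational number. If $f^n(\lambda)=\lambda_{p/q}$, then $G_\lambda$ is parabolic dust or $G_\lambda$ is not a free group. -/

import Mathlib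

open scoped MatrixGroups

noncomputable section

namespace TwoParabolic

/-- The lift `S = (1 0; 1 1)` to `SL(2, ℂ)`, of trace `2`, of the first generator. -/
def matS : SL(2, ℂ) := ⟨!![1, 0; 1, 1], by simp [Matrix.det_fin_two_of]⟩

/-- The lift `T_lam = (1 2lam; 0 1)` to `SL(2, ℂ)`, of trace `2`, of the second generator. -/
def matT (lam : ℂ) : SL(2, ℂ) := ⟨!![1, 2 * lam; 0, 1], by simp [Matrix.det_fin_two_of]⟩

/-- The image in the Möbius group `PSL(2, ℂ)` of a matrix of determinant one. -/
def toMoebius : SL(2, ℂ) →* PSL(2, ℂ) := QuotientGroup.mk' _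

/-- The two-parabolic group `G_lam`: the subgroup of the Möbius group generated by the classes of
`S` and `T_lam`. -/
def group (lam : ℂ) : Subgroup PSL(2, ℂ) :=
  Subgroup.closure {toMoebius matS, toMoebius (matT lam)}

/-- A Möbius transformation is parabolic if the matrices that represent it are parabolic, that is,
non-scalar with `trace ^ 2 = 4` (so that it is not the identity and has a lift of trace `2`). -/
def IsParabolic (h : PSL(2, ℂ)) : Prop :=
  ∃ A : SL(2, ℂ), toMoebius A = h ∧ (A : Matrix (Fin 2) (Fin 2) ℂ).IsParabolic

/-- `h` is a primitive parabolic of `G`: a parabolic element of `G` such that `h = g ^ m` with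
`g ∈ G` and `m` an integer forces `m = ± 1`. -/
def IsPrimitiveParabolic (G : Subgroup PSL(2, ℂ)) (h : PSL(2, ℂ)) : Prop :=
  h ∈ G ∧ IsParabolic h ∧ ∀ g ∈ G, ∀ m : ℤ, h = g ^ m → m = 1 ∨ m = -1

/-- `h` is conjugate in `G` to `k` or to `k⁻¹`, that is, the cyclic groups that `h` and `k` generate
(for parabolic `h` and `k`) are conjugate in `G`. -/
def ConjUpToInv (G : Subgroup PSL(2, ℂ)) (h k : PSL(2, ℂ)) : Prop :=
  ∃ g ∈ G, g * h * g⁻¹ = k ∨ g * h * g⁻¹ = k⁻¹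

/-- `G` is parabolic dust: it has at least three conjugacy classes of primitive parabolics.
A parabolic and its inverse count as one class; otherwise the two generators and their
inverses would already give four classes in every free group `G_lam`. -/
def IsParabolicDust (G : Subgroup PSL(2, ℂ)) : Prop :=
  ∃ h : Fin 3 → PSL(2, ℂ),
    (∀ i, IsPrimitiveParabolic G (h i)) ∧ ∀ i j, i ≠ j → ¬ ConjUpToInv G (h i) (h j)

/-- The map `f(z) = -2 z ^ 2` on parameters. -/
def f (z : ℂ) : ℂ := -2 * z ^ 2

/-- The sign `(-1) ^ ⌊i r⌋`. -/
def fareySign (r : ℚ) (i : ℕ) : ℤ := if Even ⌊(i : ℚ) * r⌋ then 1 else -1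

/-- The Farey word `W_r`, `r = p / q` in lowest terms with `q ≥ 1`, in the free group on two
letters `S = of 0` and `T = of 1`. It is the word of length `2 q` read off from the simple closed
curve of slope `p / q` on the four-punctured sphere `(ℝ² \ ℤ²) / (half-turns about ℤ²)`:
a line of slope `p / q` that misses `ℤ²` is followed across the columns
`x = 0, 1, …, 2 q - 1`, and crossing column `i` between the heights `j = ⌊i p / q⌋` and `j + 1`
contributes `S ^ ((-1) ^ j)` for even `i` and `T ^ (-(-1) ^ j)` for odd `i`.
Thus `W_0 = S T⁻¹`, `W_1 = S T`, `W_{1/2} = S T⁻¹ S⁻¹ T`. -/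
def fareyWord (r : ℚ) : FreeGroup (Fin 2) :=
  ((List.range (2 * r.den)).map fun i =>
    if Even i then FreeGroup.of 0 ^ fareySign r i else FreeGroup.of 1 ^ (-fareySign r i)).prod

/-- The matrix in `SL(2, ℂ)` obtained from a word by substituting the lifts `S` and `T_lam`. -/
def evalWord (lam : ℂ) : FreeGroup (Fin 2) →* SL(2, ℂ) :=
  FreeGroup.lift ![matS, matT lam]

/-- `mu` is a cusp parameter `lam_r`: the trace of the Farey word `W_r` at `mu` equals `-2`. -/
def IsCuspParameter (r : ℚ) (mu : ℂ) : Prop :=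
  (evalWord mu (fareyWord r) : Matrix (Fin 2) (Fin 2) ℂ).trace = -2

end TwoParabolic

end

/-! If `G_lam` is free, it lifts to `SL(2, ℂ)` with both generators lifted to the given matrices of
trace 2. All powers of the generators, and their conjugates, then have trace 2. A word of trace -2
is a nontrivial parabolic; its root in the free group is primitive, still parabolic, and conjugate
to no generator or inverse: otherwise the word would be conjugate to a power of a generator and have
trace 2. With `S` and `T` this gives three classes (`isParabolicDust_of_trace_eq`), for any word of
trace -2. Iteration of `f` is handled by finding inside `G_lam` a conjugate of `G_{f(lam)}`,
generated by `S` and `T S T⁻¹` (`exists_evalWord_f_eq_conj`), so a word of trace -2 at `f^n(lam)`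
yields one at `lam`. Freeness does not provide `S`, `T` as a basis; exponent sums, obtained from the
abelianization, replace that. -/

namespace TwoParabolic

/-! ### Free groups: exponent sums and roots. -/

section FreeGroups

/-- A free group on one generator consists of the powers of that generator. -/
theorem exists_zpow_of_basis_unique {ι G : Type*} [Group G] [Unique ι] (b : FreeGroupBasis ι G)
    (g : G) : ∃ k : ℤ, g = b default ^ k := by
  have key : ∀ w : FreeGroup ι, ∃ k : ℤ, w = FreeGroup.of default ^ k := by
    intro w
    induction w using FreeGroup.induction_on with
    | C1 => exact ⟨0, by simp⟩
    | of i => exact ⟨1, by simp [Subsingleton.elim i default]⟩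
    | inv_of i _ => exact ⟨-1, by simp [Subsingleton.elim i default]⟩
    | mul x y hx hy =>
      obtain ⟨k, rfl⟩ := hx
      obtain ⟨l, rfl⟩ := hy
      exact ⟨k + l, by rw [zpow_add]⟩
  obtain ⟨k, hk⟩ := key (b.repr g)
  refine ⟨k, b.repr.injective ?_⟩
  rw [hk, map_zpow, b.repr_apply_coe]

/-- A nonabelian free group surjects onto `ℤ²`. -/
theorem exists_dual_pair_of_not_commute {G : Type*} [Group G] [IsFreeGroup G] {s t : G}
    (hst : s * t ≠ t * s) :
    ∃ (x y : G) (φ ψ : G →* Multiplicative ℤ), φ x = .ofAdd 1 ∧ φ y = 1 ∧ ψ x = 1 ∧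
      ψ y = .ofAdd 1 := by
  classical
  obtain ⟨ι, ⟨b⟩⟩ := IsFreeGroup.nonempty_basis (G := G)
  have hι : Nontrivial ι := by
    by_contra h
    rw [not_nontrivial_iff_subsingleton] at h
    rcases isEmpty_or_nonempty ι with hι | ⟨⟨i⟩⟩
    · have : Subsingleton G := b.repr.toEquiv.subsingleton
      exact hst (Subsingleton.elim _ _)
    · have : Unique ι := ⟨⟨i⟩, fun _ => Subsingleton.elim _ _⟩
      obtain ⟨k, rfl⟩ := exists_zpow_of_basis_unique b s
      obtain ⟨l, rfl⟩ := exists_zpow_of_basis_unique b t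
      exact hst (zpow_mul_comm _ k l)
  obtain ⟨i, j, hij⟩ := exists_pair_ne ι
  have hl : ∀ (u : ι → Multiplicative ℤ) k, b.lift u (b k) = u k := fun u k => by
    rw [b.lift_apply_apply, b.repr_apply_coe, FreeGroup.lift_apply_of]
  refine ⟨b i, b j, b.lift fun k => if k = i then .ofAdd 1 else 1,
    b.lift fun k => if k = j then .ofAdd 1 else 1, ?_⟩
  simp [hl, hij, hij.symm]

/-- Two noncommuting generators of a free group map to a basis of `ℤ²`: the exponent sums in the
two generators are well defined. -/
theorem exists_exponent_sums {G : Type*} [Group G] [IsFreeGroup G] {s t : G}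
    (hgen : Subgroup.closure {s, t} = ⊤) (hst : s * t ≠ t * s) :
    ∃ α β : G →* Multiplicative ℤ, α s = .ofAdd 1 ∧ α t = 1 ∧ β s = 1 ∧ β t = .ofAdd 1 := by
  obtain ⟨x, y, φ, ψ, hφx, hφy, hψx, hψy⟩ := exists_dual_pair_of_not_commute hst
  have hspan : ∀ g : G, ∃ m n : ℤ, φ g = φ s ^ m * φ t ^ n ∧ ψ g = ψ s ^ m * ψ t ^ n := by
    intro g
    have hg : g ∈ Subgroup.closure {s, t} := hgen ▸ Subgroup.mem_top g
    induction hg using Subgroup.closure_induction with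
    | mem g hg =>
      rcases hg with rfl | rfl
      · exact ⟨1, 0, by simp⟩
      · exact ⟨0, 1, by simp⟩
    | one => exact ⟨0, 0, by simp⟩
    | mul g h _ _ hg hh =>
      obtain ⟨m, n, h1, h2⟩ := hg
      obtain ⟨m', n', h3, h4⟩ := hh
      refine ⟨m + m', n + n', ?_, ?_⟩
      · rw [map_mul, h1, h3, zpow_add, zpow_add, mul_mul_mul_comm]
      · rw [map_mul, h2, h4, zpow_add, zpow_add, mul_mul_mul_comm]
    | inv g _ hg =>
      obtain ⟨m, n, h1, h2⟩ := hg
      refine ⟨-m, -n, ?_, ?_⟩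
      · rw [map_inv, h1, zpow_neg, zpow_neg, mul_inv]
      · rw [map_inv, h2, zpow_neg, zpow_neg, mul_inv]
  obtain ⟨m, n, h1, h2⟩ := hspan x
  obtain ⟨m', n', h3, h4⟩ := hspan y
  rw [hφx] at h1
  rw [hψx] at h2
  rw [hφy] at h3
  rw [hψy] at h4
  replace h1 : 1 = m * (φ s).toAdd + n * (φ t).toAdd := congrArg Multiplicative.toAdd h1
  replace h2 : 0 = m * (ψ s).toAdd + n * (ψ t).toAdd := congrArg Multiplicative.toAdd h2
  replace h3 : 0 = m' * (φ s).toAdd + n' * (φ t).toAdd := congrArg Multiplicative.toAdd h3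
  replace h4 : 1 = m' * (ψ s).toAdd + n' * (ψ t).toAdd := congrArg Multiplicative.toAdd h4
  -- A one-sided inverse of a square integer matrix is two-sided; the reversed product contains the
  -- values of the combinations of `φ` and `ψ` chosen below.
  have hinv : !![m, n; m', n'] * !![(φ s).toAdd, (ψ s).toAdd; (φ t).toAdd, (ψ t).toAdd] = 1 := by
    rw [Matrix.mul_fin_two, ← h1, ← h2, ← h3, ← h4, Matrix.one_fin_two]
  rw [mul_eq_one_comm, Matrix.mul_fin_two, Matrix.one_fin_two] at hinv
  refine ⟨φ ^ m * ψ ^ m', φ ^ n * ψ ^ n', ?_, ?_, ?_, ?_⟩ <;> apply Multiplicative.toAdd.injective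
  · simpa [mul_comm] using congrFun₂ hinv 0 0
  · simpa [mul_comm] using congrFun₂ hinv 1 0
  · simpa [mul_comm] using congrFun₂ hinv 0 1
  · simpa [mul_comm] using congrFun₂ hinv 1 1

/-- A nontrivial element of a free group with abelian centralizer is a power of an element that is
not a proper power. -/
theorem exists_root {G : Type*} [Group G] [IsFreeGroup G] {w : G} (hw : w ≠ 1)
    (hcomm : ∀ g h : G, Commute g w → Commute h w → Commute g h) :
    ∃ (g : G) (k : ℤ), w = g ^ k ∧ ∀ (h : G) (m : ℤ), g = h ^ m → m = 1 ∨ m = -1 := by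
  let C := Subgroup.centralizer {w}
  have hC : ∀ g, g ∈ C ↔ Commute g w := fun g => by
    rw [Subgroup.mem_centralizer_singleton_iff]; rfl
  -- The centralizer is free by Nielsen–Schreier; being abelian and nontrivial, it is infinite
  -- cyclic, and its generator is the root.
  obtain ⟨ι, ⟨b⟩⟩ := IsFreeGroup.nonempty_basis (G := C)
  have hwC : w ∈ C := (hC w).2 (Commute.refl w)
  have hsub : Subsingleton ι := by
    by_contra h
    rw [not_subsingleton_iff_nontrivial] at h
    classical
    obtain ⟨i, j, hij⟩ := exists_pair_ne ι
    have hb : b i * b j = b j * b i :=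
      Subtype.ext (hcomm _ _ ((hC _).1 (b i).2) ((hC _).1 (b j).2))
    -- Two basis elements cannot commute: they can be sent to noncommuting transpositions.
    let θ : C →* Equiv.Perm (Fin 3) := b.lift fun k => if k = i then .swap 0 1 else .swap 1 2
    have hθ : ∀ k, θ (b k) = if k = i then .swap 0 1 else .swap 1 2 := fun k => by
      rw [b.lift_apply_apply, b.repr_apply_coe, FreeGroup.lift_apply_of]
    have h := congrArg θ hb
    rw [map_mul, map_mul, hθ, hθ, if_pos rfl, if_neg hij.symm] at h
    revert h
    decide
  have hne : Nonempty ι := by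
    by_contra h
    rw [not_nonempty_iff] at h
    have : Subsingleton C := b.repr.toEquiv.subsingleton
    exact hw (congrArg Subtype.val (Subsingleton.elim (⟨w, hwC⟩ : C) 1))
  have : Unique ι := ⟨⟨hne.some⟩, fun _ => Subsingleton.elim _ _⟩
  obtain ⟨k, hk⟩ := exists_zpow_of_basis_unique b ⟨w, hwC⟩
  refine ⟨b default, k, congrArg Subtype.val hk, fun h m hm => ?_⟩
  have hh : h ∈ C := by
    refine (hC h).2 ?_
    have : w = h ^ (m * k) := by
      rw [zpow_mul, ← hm]; exact congrArg Subtype.val hk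
    rw [this]
    exact Commute.self_zpow h _
  let δ : C →* Multiplicative ℤ := b.lift fun _ => .ofAdd 1
  have hδ : δ (b default) = .ofAdd 1 := by
    rw [b.lift_apply_apply, b.repr_apply_coe, FreeGroup.lift_apply_of]
  have h1 : b default = (⟨h, hh⟩ : C) ^ m := Subtype.ext hm
  rw [h1, map_zpow] at hδ
  have h2 : m * (δ ⟨h, hh⟩).toAdd = 1 := congrArg Multiplicative.toAdd hδ
  exact Int.eq_one_or_neg_one_of_mul_eq_one h2

end FreeGroups

/-! ### Traces, parabolicity and commutants of 2 × 2 matrices. -/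

section Matrices

theorem toMoebius_eq_iff {A B : SL(2, ℂ)} : toMoebius A = toMoebius B ↔ B = A ∨ B = -A := by
  rw [toMoebius, QuotientGroup.mk'_apply, QuotientGroup.mk'_apply, QuotientGroup.eq,
    Matrix.SpecialLinearGroup.mem_center_iff]
  constructor
  · rintro ⟨c, hc, h⟩
    rw [Fintype.card_fin, sq_eq_one_iff] at hc
    rcases hc with rfl | rfl
    · left
      have : A⁻¹ * B = 1 := Subtype.ext (by simpa using h.symm)
      rw [inv_mul_eq_one.1 this]
    · right
      have : A⁻¹ * B = -1 := Subtype.ext (by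
        rw [← h, map_neg, map_one, Matrix.SpecialLinearGroup.coe_neg,
          Matrix.SpecialLinearGroup.coe_one])
      rw [inv_mul_eq_iff_eq_mul.1 this, mul_neg, mul_one]
  · rintro (rfl | rfl)
    · exact ⟨1, by simp, by simp⟩
    · refine ⟨-1, by simp, ?_⟩
      rw [mul_neg, inv_mul_cancel, map_neg, map_one, Matrix.SpecialLinearGroup.coe_neg,
        Matrix.SpecialLinearGroup.coe_one]

theorem matS_zpow (k : ℤ) : (matS ^ k : SL(2, ℂ)).1.trace = 2 := by
  suffices ((matS ^ k : SL(2, ℂ)) : Matrix (Fin 2) (Fin 2) ℂ) = !![1, 0; (k : ℂ), 1] by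
    rw [this, Matrix.trace_fin_two_of]; norm_num
  induction k with
  | zero => simp [Matrix.one_fin_two]
  | succ k ih =>
    rw [zpow_add_one, Matrix.SpecialLinearGroup.coe_mul, ih]
    simp [matS]
  | pred k ih =>
    rw [zpow_sub_one, Matrix.SpecialLinearGroup.coe_mul, ih, Matrix.SpecialLinearGroup.coe_inv]
    simp [matS, Matrix.adjugate_fin_two, sub_eq_add_neg]

theorem matT_zpow (lam : ℂ) (k : ℤ) : (matT lam ^ k : SL(2, ℂ)).1.trace = 2 := by
  suffices ((matT lam ^ k : SL(2, ℂ)) : Matrix (Fin 2) (Fin 2) ℂ) = !![1, k * (2 * lam); 0, 1] by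
    rw [this, Matrix.trace_fin_two_of]; norm_num
  induction k with
  | zero => simp [Matrix.one_fin_two]
  | succ k ih =>
    rw [zpow_add_one, Matrix.SpecialLinearGroup.coe_mul, ih]
    simp [matT]; ring
  | pred k ih =>
    rw [zpow_sub_one, Matrix.SpecialLinearGroup.coe_mul, ih, Matrix.SpecialLinearGroup.coe_inv]
    simp [matT, Matrix.adjugate_fin_two]; ring

theorem trace_conj (U A : SL(2, ℂ)) :
    (U * A * U⁻¹ : SL(2, ℂ)).1.trace = A.1.trace := by
  rw [Matrix.SpecialLinearGroup.coe_mul, Matrix.trace_mul_comm,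
    ← Matrix.SpecialLinearGroup.coe_mul, ← mul_assoc, inv_mul_cancel, one_mul]

theorem isParabolic_matS : (matS : Matrix (Fin 2) (Fin 2) ℂ).IsParabolic := by
  refine ⟨?_, ?_⟩
  · rintro ⟨c, hc⟩
    simpa [matS] using congrFun₂ hc 1 0
  · rw [Matrix.discr_fin_two, Matrix.SpecialLinearGroup.det_coe]
    simp [matS, Matrix.trace_fin_two]; norm_num

theorem isParabolic_matT {lam : ℂ} (hlam : lam ≠ 0) :
    (matT lam : Matrix (Fin 2) (Fin 2) ℂ).IsParabolic := by
  refine ⟨?_, ?_⟩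
  · rintro ⟨c, hc⟩
    exact hlam (by simpa [matT] using congrFun₂ hc 0 1)
  · rw [Matrix.discr_fin_two, Matrix.SpecialLinearGroup.det_coe]
    simp [matT, Matrix.trace_fin_two]; norm_num

theorem toMoebius_matS_mul_matT_ne {lam : ℂ} (hlam : lam ≠ 0) :
    toMoebius matS * toMoebius (matT lam) ≠ toMoebius (matT lam) * toMoebius matS := by
  rw [← map_mul, ← map_mul, Ne, toMoebius_eq_iff]
  rintro (h | h)
  · have := congrFun₂ (congrArg Subtype.val h) 0 0
    rw [Matrix.SpecialLinearGroup.coe_mul, Matrix.SpecialLinearGroup.coe_mul] at this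
    simp [matS, matT, hlam] at this
  · have := congrFun₂ (congrArg Subtype.val h) 1 0
    rw [Matrix.SpecialLinearGroup.coe_neg, Matrix.SpecialLinearGroup.coe_mul,
      Matrix.SpecialLinearGroup.coe_mul] at this
    simp [matS, matT] at this
    norm_num [eq_neg_iff_add_eq_zero] at this

/-- A nonscalar 2 × 2 matrix has a cyclic vector, so its commutant is the algebra of polynomials in
it. The cases choose a nonzero entry, or difference of diagonal entries, to solve for the
coefficients. -/
theorem exists_eq_of_commute_nonscalar {W : Matrix (Fin 2) (Fin 2) ℂ}
    (hW : W ∉ Set.range (Matrix.scalar (Fin 2))) {A : Matrix (Fin 2) (Fin 2) ℂ}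
    (hA : A * W = W * A) : ∃ a b : ℂ, A = a • 1 + b • W := by
  have h00 := congrFun₂ hA 0 0
  have h01 := congrFun₂ hA 0 1
  have h10 := congrFun₂ hA 1 0
  simp only [Matrix.mul_apply, Fin.sum_univ_two] at h00 h01 h10
  suffices ∃ a b : ℂ, A 0 0 = a + b * W 0 0 ∧ A 0 1 = b * W 0 1 ∧ A 1 0 = b * W 1 0 ∧
      A 1 1 = a + b * W 1 1 by
    obtain ⟨a, b, h1, h2, h3, h4⟩ := this
    refine ⟨a, b, ?_⟩
    ext i j
    fin_cases i <;> fin_cases j <;> simpa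
  by_cases h1 : W 0 1 = 0
  · by_cases h2 : W 1 0 = 0
    · have h3 : W 0 0 - W 1 1 ≠ 0 := fun h => hW ⟨W 0 0, by
        ext i j
        fin_cases i <;> fin_cases j <;> simp [h1, h2, sub_eq_zero.1 h]⟩
      refine ⟨A 0 0 - (A 0 0 - A 1 1) / (W 0 0 - W 1 1) * W 0 0,
        (A 0 0 - A 1 1) / (W 0 0 - W 1 1), ?_⟩
      have h4 : A 0 1 = 0 := by
        refine (mul_eq_zero.1 ?_).resolve_left h3
        rw [h1] at h01; linear_combination -h01
      have h5 : A 1 0 = 0 := by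
        refine (mul_eq_zero.1 ?_).resolve_left h3
        rw [h2] at h10; linear_combination h10
      rw [h1, h2, h4, h5]
      refine ⟨by ring, by ring, by ring, ?_⟩
      field_simp; ring
    · refine ⟨A 0 0 - A 1 0 / W 1 0 * W 0 0, A 1 0 / W 1 0, by ring, ?_, by field_simp, ?_⟩
      · field_simp; linear_combination h00
      · field_simp; linear_combination h10
  · refine ⟨A 0 0 - A 0 1 / W 0 1 * W 0 0, A 0 1 / W 0 1, by ring, by field_simp, ?_, ?_⟩
    · field_simp; linear_combination -h00
    · field_simp; linear_combination -h01

/-- A matrix that commutes with a parabolic one has discriminant zero. -/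
theorem discr_eq_zero_of_commute {W A : Matrix (Fin 2) (Fin 2) ℂ} (hW : W.IsParabolic)
    (hA : A * W = W * A) : A.discr = 0 := by
  obtain ⟨a, b, rfl⟩ := exists_eq_of_commute_nonscalar hW.1 hA
  have h := hW.2
  rw [Matrix.discr_fin_two, Matrix.trace_fin_two, Matrix.det_fin_two] at h ⊢
  simp
  linear_combination b ^ 2 * h

/-- The centralizer of a nonscalar `2 × 2` matrix is commutative. -/
theorem mul_comm_of_commute_nonscalar {W : Matrix (Fin 2) (Fin 2) ℂ}
    (hW : W ∉ Set.range (Matrix.scalar (Fin 2))) {A B : Matrix (Fin 2) (Fin 2) ℂ}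
    (hA : A * W = W * A) (hB : B * W = W * B) : A * B = B * A := by
  obtain ⟨a, b, rfl⟩ := exists_eq_of_commute_nonscalar hW hA
  simp [add_mul, mul_add, hB]

end Matrices

/-! ### Lifting a free `G_lam` to `SL(2, ℂ)`. -/

section LiftToSL

/-- The first generator of `G_lam`. -/
def genS (lam : ℂ) : group lam := ⟨toMoebius matS, Subgroup.subset_closure (by simp)⟩

/-- The second generator of `G_lam`. -/
def genT (lam : ℂ) : group lam := ⟨toMoebius (matT lam), Subgroup.subset_closure (by simp)⟩

theorem closure_genS_genT (lam : ℂ) : Subgroup.closure {genS lam, genT lam} = ⊤ := by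
  have h := Subgroup.closure_closure_coe_preimage
    (k := {toMoebius matS, toMoebius (matT lam)})
  convert! h using 2
  ext x
  simp only [genS, genT, Set.mem_insert_iff, Set.mem_singleton_iff, Subtype.ext_iff]
  rfl

theorem genS_mul_genT_ne {lam : ℂ} (hlam : lam ≠ 0) :
    genS lam * genT lam ≠ genT lam * genS lam :=
  fun h => toMoebius_matS_mul_matT_ne hlam (congrArg Subtype.val h)

open scoped IsMulCommutative in
/-- If `G_lam` is free, it lifts to `SL(2, ℂ)` with prescribed lifts of the two generators. -/
theorem exists_lift_hom {lam : ℂ} (hlam : lam ≠ 0) [IsFreeGroup (group lam)] :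
    ∃ σ : group lam →* SL(2, ℂ), (∀ g, toMoebius (σ g) = g) ∧ σ (genS lam) = matS ∧
      σ (genT lam) = matT lam := by
  obtain ⟨α, β, hαs, hαt, hβs, hβt⟩ :=
    exists_exponent_sums (closure_genS_genT lam) (genS_mul_genT_ne hlam)
  obtain ⟨ι, ⟨b⟩⟩ := IsFreeGroup.nonempty_basis (G := group lam)
  choose r hr using QuotientGroup.mk'_surjective (Subgroup.center SL(2, ℂ))
  let s : group lam →* SL(2, ℂ) := b.lift fun i => r (b i)
  have hs : ∀ g, toMoebius (s g) = g := by
    have : toMoebius.comp s = (group lam).subtype := by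
      refine b.ext_hom _ _ fun i => ?_
      rw [MonoidHom.comp_apply, b.lift_apply_apply, b.repr_apply_coe, FreeGroup.lift_apply_of]
      exact hr _
    exact DFunLike.congr_fun this
  have hker : ∀ A : SL(2, ℂ), toMoebius A = 1 ↔ A ∈ Subgroup.center SL(2, ℂ) :=
    fun A => QuotientGroup.eq_one_iff A
  let c : Subgroup.center SL(2, ℂ) := ⟨matS * (s (genS lam))⁻¹, (hker _).1 (by
    rw [map_mul, map_inv, hs]; exact mul_inv_cancel _)⟩
  let d : Subgroup.center SL(2, ℂ) := ⟨matT lam * (s (genT lam))⁻¹, (hker _).1 (by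
    rw [map_mul, map_inv, hs]; exact mul_inv_cancel _)⟩
  -- The arbitrary lift `s` is off by central factors `c`, `d` on the generators; the exponent sums
  -- extend these to a character that corrects it.
  let χ : group lam →* Subgroup.center SL(2, ℂ) :=
    (zpowersHom _ c).comp α * (zpowersHom _ d).comp β
  have hχs : χ (genS lam) = c := by simp [χ, hαs, hβs, zpowersHom_apply]
  have hχt : χ (genT lam) = d := by simp [χ, hαt, hβt, zpowersHom_apply]
  refine ⟨MonoidHom.mk' (fun g => (χ g : SL(2, ℂ)) * s g) fun g h => ?_, fun g => ?_, ?_, ?_⟩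
  · rw [map_mul, map_mul, Subgroup.coe_mul, mul_assoc, mul_assoc, ← mul_assoc _ (s g),
      ← mul_assoc (s g), Subgroup.mem_center_iff.1 (χ h).2 (s g)]
  · rw [MonoidHom.mk'_apply, map_mul, hs, (hker _).2 (χ g).2, one_mul]
  · rw [MonoidHom.mk'_apply, hχs, inv_mul_cancel_right]
  · rw [MonoidHom.mk'_apply, hχt, inv_mul_cancel_right]

/-- The element of `G_lam` that a word represents. -/
def wordHom (lam : ℂ) : FreeGroup (Fin 2) →* group lam := FreeGroup.lift ![genS lam, genT lam]

theorem map_wordHom {lam : ℂ} {σ : group lam →* SL(2, ℂ)} (hs : σ (genS lam) = matS)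
    (ht : σ (genT lam) = matT lam) (w : FreeGroup (Fin 2)) : σ (wordHom lam w) = evalWord lam w := by
  have : σ.comp (wordHom lam) = evalWord lam := by
    refine FreeGroup.ext_hom _ _ fun i => ?_
    fin_cases i <;> simp [wordHom, evalWord, hs, ht]
  exact DFunLike.congr_fun this w

end LiftToSL

/-! ### Three classes of primitive parabolics. -/

section ParabolicDust

theorem ConjUpToInv.symm {G : Subgroup PSL(2, ℂ)} {h k : PSL(2, ℂ)} (H : ConjUpToInv G h k) :
    ConjUpToInv G k h := by
  obtain ⟨u, hu, rfl | H⟩ := H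
  · exact ⟨u⁻¹, G.inv_mem hu, .inl (by group)⟩
  · rw [← inv_inj, inv_inv] at H
    subst H
    exact ⟨u⁻¹, G.inv_mem hu, .inr (by group)⟩

theorem conjUpToInv_coe {G : Subgroup PSL(2, ℂ)} {h k : G} (H : ConjUpToInv G h k) :
    ∃ u : G, ∃ e : ℤ, k = u * h ^ e * u⁻¹ := by
  obtain ⟨u, hu, H | H⟩ := H
  · exact ⟨⟨u, hu⟩, 1, Subtype.ext (by rw [zpow_one]; exact H.symm)⟩
  · refine ⟨⟨u, hu⟩, -1, ?_⟩
    rw [zpow_neg_one, ← conj_inv]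
    exact inv_eq_iff_eq_inv.1 (Subtype.ext H.symm)

/-- A free group `G_lam` that contains an element whose distinguished lift to `SL(2, ℂ)` has trace
`-2` is parabolic dust: the two generators and the root of that element are primitive parabolics in
different classes, since powers of the generators lift to matrices of trace `2`. -/
theorem isParabolicDust_of_trace_eq {lam : ℂ} (hlam : lam ≠ 0) [IsFreeGroup (group lam)]
    (w : FreeGroup (Fin 2))
    (hw : (evalWord lam w : Matrix (Fin 2) (Fin 2) ℂ).trace = -2) :
    IsParabolicDust (group lam) := by
  obtain ⟨α, β, hαs, hαt, hβs, hβt⟩ :=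
    exists_exponent_sums (closure_genS_genT lam) (genS_mul_genT_ne hlam)
  obtain ⟨σ, hσ, hσs, hσt⟩ := exists_lift_hom hlam
  have hinj : Function.Injective σ := fun g h hgh => Subtype.ext (by rw [← hσ, hgh, hσ])
  have hscalar : ∀ g, (σ g : Matrix (Fin 2) (Fin 2) ℂ) ∈ Set.range (Matrix.scalar (Fin 2)) →
      g = 1 := by
    rintro g ⟨c, hc⟩
    have h : σ g ∈ Subgroup.center SL(2, ℂ) := by
      refine Matrix.SpecialLinearGroup.mem_center_iff.2 ⟨c, ?_, hc⟩
      have := congrArg Matrix.det hc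
      rwa [Matrix.SpecialLinearGroup.det_coe, Matrix.scalar_apply, Matrix.det_diagonal,
        Finset.prod_const, Finset.card_univ] at this
    refine Subtype.ext ?_
    rw [← hσ]
    exact (QuotientGroup.eq_one_iff (σ g)).2 h
  have hW : (σ (wordHom lam w) : Matrix (Fin 2) (Fin 2) ℂ).trace = -2 := by
    rwa [map_wordHom hσs hσt]
  generalize wordHom lam w = W at hW
  have hW1 : W ≠ 1 := by
    rintro rfl
    rw [map_one, Matrix.SpecialLinearGroup.coe_one, Matrix.trace_one] at hW
    norm_num at hW
  have hWpar : (σ W : Matrix (Fin 2) (Fin 2) ℂ).IsParabolic := by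
    refine ⟨fun h => hW1 (hscalar W h), ?_⟩
    rw [Matrix.discr_fin_two, Matrix.SpecialLinearGroup.det_coe, hW]
    norm_num
  have hcoe : ∀ g h : group lam, Commute g h →
      (σ g : Matrix (Fin 2) (Fin 2) ℂ) * (σ h : Matrix (Fin 2) (Fin 2) ℂ) = σ h * σ g := by
    intro g h H
    rw [← Matrix.SpecialLinearGroup.coe_mul, ← Matrix.SpecialLinearGroup.coe_mul, ← map_mul,
      ← map_mul, H.eq]
  obtain ⟨g, k, hgk, hg⟩ := exists_root hW1 fun g h hg hh => by
    refine hinj (Subtype.ext ?_)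
    rw [map_mul, map_mul, Matrix.SpecialLinearGroup.coe_mul, Matrix.SpecialLinearGroup.coe_mul]
    exact mul_comm_of_commute_nonscalar hWpar.1 (hcoe g W hg) (hcoe h W hh)
  have hgpar : (σ g : Matrix (Fin 2) (Fin 2) ℂ).IsParabolic := by
    refine ⟨fun h => hW1 ?_, discr_eq_zero_of_commute hWpar (hcoe g W ?_)⟩
    · rw [hgk, hscalar g h, one_zpow]
    · rw [hgk]; exact Commute.self_zpow g k
  have hprim : ∀ x : group lam, (σ x : Matrix (Fin 2) (Fin 2) ℂ).IsParabolic →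
      (∀ (h : group lam) (m : ℤ), x = h ^ m → m = 1 ∨ m = -1) →
      IsPrimitiveParabolic (group lam) x := fun x hx hroot =>
    ⟨x.2, ⟨σ x, hσ x, hx⟩, fun h hh m hm => hroot ⟨h, hh⟩ m (Subtype.ext hm)⟩
  have hexp : ∀ (γ : group lam →* Multiplicative ℤ) (x : group lam), γ x = .ofAdd 1 →
      ∀ (h : group lam) (m : ℤ), x = h ^ m → m = 1 ∨ m = -1 := by
    intro γ x hx h m hm
    rw [hm, map_zpow] at hx
    have h2 : m * (γ h).toAdd = 1 := congrArg Multiplicative.toAdd hx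
    exact Int.eq_one_or_neg_one_of_mul_eq_one h2
  have hconj : ∀ x : group lam, (∀ j : ℤ, (σ x ^ j : SL(2, ℂ)).1.trace = 2) →
      ¬ ConjUpToInv (group lam) x g := by
    intro x hx H
    obtain ⟨u, e, rfl⟩ := conjUpToInv_coe H
    -- Here `W` is the conjugate of `x ^ (e * k)`, so its trace would be both 2 and -2.
    rw [hgk, conj_zpow, ← zpow_mul, map_mul, map_mul, map_inv, map_zpow, trace_conj, hx] at hW
    norm_num at hW
  have h01 : ¬ ConjUpToInv (group lam) (genS lam) (genT lam) := by
    intro H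
    obtain ⟨u, e, hu⟩ := conjUpToInv_coe H
    have h := congrArg β hu
    rw [map_mul, map_mul, map_inv, map_zpow, hβs, hβt, one_zpow, mul_one, mul_inv_cancel] at h
    exact absurd (congrArg Multiplicative.toAdd h) one_ne_zero
  have h02 : ¬ ConjUpToInv (group lam) (genS lam) g := hconj _ fun j => by rw [hσs, matS_zpow]
  have h12 : ¬ ConjUpToInv (group lam) (genT lam) g := hconj _ fun j => by rw [hσt, matT_zpow]
  refine ⟨![genS lam, genT lam, g], fun i => ?_, fun i j hij => ?_⟩
  · fin_cases i
    · exact hprim _ (hσs ▸ isParabolic_matS) (hexp α _ hαs)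
    · exact hprim _ (hσt ▸ isParabolic_matT hlam) (hexp β _ hβt)
    · exact hprim _ hgpar hg
  · fin_cases i <;> fin_cases j
    · exact absurd rfl hij
    · exact h01
    · exact h02
    · exact fun H => h01 H.symm
    · exact absurd rfl hij
    · exact h12
    · exact fun H => h02 H.symm
    · exact fun H => h12 H.symm
    · exact absurd rfl hij

end ParabolicDust

/-! ### Pulling words back along `f`. -/

section Semiconjugacy

/-- The substitution `S ↦ S`, `T ↦ T S T⁻¹`. -/
def substHom : FreeGroup (Fin 2) →* FreeGroup (Fin 2) :=
  FreeGroup.lift ![FreeGroup.of 0, FreeGroup.of 1 * FreeGroup.of 0 * (FreeGroup.of 1)⁻¹]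

/-- `G_{f(lam)}` is conjugate to the subgroup of `G_lam` generated by `S` and `T S T⁻¹`. -/
theorem exists_evalWord_f_eq_conj {lam : ℂ} (hlam : lam ≠ 0) :
    ∃ P : SL(2, ℂ), ∀ w, evalWord (f lam) w = P * evalWord lam (substHom w) * P⁻¹ := by
  -- `P` commutes with `S` and sends `2 * lam`, the fixed point of `T S T⁻¹`, to infinity.
  let P : SL(2, ℂ) := ⟨!![1, 0; -(2 * lam)⁻¹, 1], by simp [Matrix.det_fin_two_of]⟩
  refine ⟨P, fun w => ?_⟩
  have h : evalWord (f lam) = (MulAut.conj P).toMonoidHom.comp ((evalWord lam).comp substHom) := by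
    refine FreeGroup.ext_hom _ _ fun i => ?_
    fin_cases i
    · suffices matS = P * matS * P⁻¹ by simpa [evalWord, substHom]
      rw [eq_mul_inv_iff_mul_eq]
      apply Subtype.ext
      rw [Matrix.SpecialLinearGroup.coe_mul, Matrix.SpecialLinearGroup.coe_mul]
      simp [matS, P, add_comm]
    · suffices matT (f lam) = P * (matT lam * matS * (matT lam)⁻¹) * P⁻¹ by
        simpa [evalWord, substHom]
      rw [eq_mul_inv_iff_mul_eq, ← mul_assoc, eq_mul_inv_iff_mul_eq]
      apply Subtype.ext
      simp only [Matrix.SpecialLinearGroup.coe_mul]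
      simp only [matS, matT, P, f, Matrix.mul_fin_two]
      ext i j
      fin_cases i <;> fin_cases j <;> simp <;> field_simp <;> ring
  exact DFunLike.congr_fun h w

theorem exists_trace_evalWord_iterate_f {lam : ℂ} (hlam : lam ≠ 0) (n : ℕ)
    (w : FreeGroup (Fin 2)) :
    ∃ v, (evalWord (f^[n] lam) w).1.trace = (evalWord lam v).1.trace := by
  induction n generalizing lam with
  | zero => exact ⟨w, rfl⟩
  | succ n ih =>
    have hf : f lam ≠ 0 := mul_ne_zero (by norm_num) (pow_ne_zero 2 hlam)
    obtain ⟨v, hv⟩ := ih hf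
    obtain ⟨P, hP⟩ := exists_evalWord_f_eq_conj hlam
    exact ⟨substHom v, by rw [Function.iterate_succ_apply, hv, hP, trace_conj]⟩

end Semiconjugacy

end TwoParabolic

theorem mainTheorem11 (lam : ℂ) (hlam : lam ≠ 0) (n : ℕ) (r : ℚ) (mu : ℂ)
    (hmu : TwoParabolic.IsCuspParameter r mu) (hn : TwoParabolic.f^[n] lam = mu) :
    TwoParabolic.IsParabolicDust (TwoParabolic.group lam) ∨
      ¬ IsFreeGroup (TwoParabolic.group lam) := by
  by_cases hfree : IsFreeGroup (TwoParabolic.group lam)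
  · obtain ⟨v, hv⟩ :=
      TwoParabolic.exists_trace_evalWord_iterate_f hlam n (TwoParabolic.fareyWord r)
    subst hn
    exact .inl (TwoParabolic.isParabolicDust_of_trace_eq hlam v (hv.symm.trans hmu))
  · exact .inr hfree
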